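/- Consider the Gaussian linear regression model $y=X\beta+\varepsilon$, where $X$ is an $n\times p$ real design matrix ($p$ may exceed $n$), $\beta\in\mathbb R^p$ is unknown, $\varepsilon\sim N(0,\sigma^2I_n)$ and $\sigma>0$ is known. Let $r=\operatorname{rank}(X)$ and assume that any $r$ columns of $X$ are linearly independent. A model $M$ is a set of at most $r$ predictors, $M\subseteq\{1,\dots,p\}$, $|M|\le r$. Let $D_M$ be the diagonal $0/1$ indicator matrix of $M$, let $\hat\beta_M=(D_MX'XD_M)^+D_MX'y$ be the least squares estimate in the model $M$ ($^+$ denotes the Moore–Penrose inverse), and let $X\beta_M$ be the orthogonal projection of $X\beta$ on the span of the columns of $X$ indexed by $M$. Let $\pi$ be a prior on the model size: $\pi(k)>0$ for $k=0,\dots,r$, $\pi(k)=0$ for $k>r$, and $\sum_{k=0}^r\pi(k)=1$. For $\gamma>0$ define the penalty $$\mathrm{Pen}(k)=2\sigma^2(1+1/\gamma)\ln\left\{\binom pk\pi(k)^{-1}(1+\gamma)^{k/2}\right\},\quad k=0,\dots,r-1,$$ $$\mathrm{Pen}(r)=2\sigma^2(1+1/\gamma)\ln\left\{\pi(r)^{-1}(1+\gamma)^{r/2}\right\}.$$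 Assumption (P): $\pi(k)\le\binom pk e^{-c(\gamma)k}$ for $k=0,\dots,r-1$ and $\pi(r)\le e^{-c(\gamma)r}$, where $c(\gamma)=8(\gamma+3/4)^2$. Theorem 1. There are positive constants $c_0(\gamma)$ and $c_1(\gamma)$, depending only on $\gamma$, such that under Assumption (P) the MAP model selector $\hat M$, that is, any (measurable) solution of the penalized least squares problem $\|y-X\hat\beta_M\|^2+\mathrm{Pen}(|M|)\to\min_M$ over all models $M$, satisfies $$E\|X\hat\beta_{\hat M}-X\beta\|^2\le c_0(\gamma)\inf_M\left\{\|X\beta_M-X\beta\|^2+\mathrm{Pen}(|M|)\right\}+c_1(\gamma)\sigma^2,$$ where the expectation is finite and the infimum is over all models $M$. -/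

import Mathlib

open MeasureTheory ProbabilityTheory
open scoped Matrix

noncomputable section

namespace MAPSelection

/-- The four Penrose equations: `B` is the Moore-Penrose generalized inverse of the real
matrix `A`. -/
structure IsMoorePenrose {m n : Type*} [Fintype m] [Fintype n]
    (A : Matrix m n ℝ) (B : Matrix n m ℝ) : Prop where
  mul_mul_left : A * B * A = A
  mul_mul_right : B * A * B = B
  symm_left : (A * B)ᵀ = A * B
  symm_right : (B * A)ᵀ = B * A

theorem IsMoorePenrose.unique {m n : Type*} [Fintype m] [Fintype n]
    {A : Matrix m n ℝ} {B C : Matrix n m ℝ}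
    (hB : IsMoorePenrose A B) (hC : IsMoorePenrose A C) : B = C := by
  have h1 : A * B = A * C := by
    calc A * B = (A * B)ᵀ := hB.symm_left.symm
      _ = ((A * C) * (A * B))ᵀ := by
          rw [← Matrix.mul_assoc (A * C) A B, hC.mul_mul_left]
      _ = (A * B) * (A * C) := by
          rw [Matrix.transpose_mul, hB.symm_left, hC.symm_left]
      _ = A * C := by rw [← Matrix.mul_assoc (A * B) A C, hB.mul_mul_left]
  have h2 : B * A = C * A := by
    calc B * A = (B * A)ᵀ := hB.symm_right.symm
      _ = ((B * A) * (C * A))ᵀ := by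
          rw [Matrix.mul_assoc B A (C * A), ← Matrix.mul_assoc A C A, hC.mul_mul_left]
      _ = (C * A) * (B * A) := by
          rw [Matrix.transpose_mul, hB.symm_right, hC.symm_right]
      _ = C * A := by
          rw [Matrix.mul_assoc C A (B * A), ← Matrix.mul_assoc A B A, hB.mul_mul_left]
  calc B = B * A * B := hB.mul_mul_right.symm
    _ = C * (A * B) := by rw [h2, Matrix.mul_assoc]
    _ = C * A * C := by rw [h1, Matrix.mul_assoc]
    _ = C := hC.mul_mul_right

theorem exists_isMoorePenrose_of_isHermitian {n : Type*} [Fintype n] [DecidableEq n]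
    {A : Matrix n n ℝ} (hA : A.IsHermitian) :
    ∃ B : Matrix n n ℝ, Bᵀ = B ∧ IsMoorePenrose A B := by
  obtain ⟨U, d, hU, hA'⟩ : ∃ (U : Matrix n n ℝ) (d : n → ℝ), Uᵀ * U = 1 ∧
      A = U * Matrix.diagonal d * Uᵀ := by
    refine ⟨hA.eigenvectorUnitary, hA.eigenvalues, ?_, ?_⟩
    · have := (Matrix.mem_unitaryGroup_iff' (A := (hA.eigenvectorUnitary : Matrix n n ℝ))).1
        hA.eigenvectorUnitary.2
      simpa [Matrix.star_eq_conjTranspose] using this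
    · have := hA.spectral_theorem
      rw [Unitary.conjStarAlgAut_apply] at this
      simpa [Matrix.star_eq_conjTranspose, Function.comp_def] using this
  have key : ∀ a b : n → ℝ, (U * Matrix.diagonal a * Uᵀ) * (U * Matrix.diagonal b * Uᵀ)
      = U * Matrix.diagonal (fun i => a i * b i) * Uᵀ := by
    intro a b
    calc (U * Matrix.diagonal a * Uᵀ) * (U * Matrix.diagonal b * Uᵀ)
        = U * Matrix.diagonal a * (Uᵀ * U) * Matrix.diagonal b * Uᵀ := by
          simp only [Matrix.mul_assoc]
      _ = _ := by
          rw [hU, Matrix.mul_one, Matrix.mul_assoc U, Matrix.diagonal_mul_diagonal]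
  have keyT : ∀ a : n → ℝ, (U * Matrix.diagonal a * Uᵀ)ᵀ = U * Matrix.diagonal a * Uᵀ := by
    intro a
    simp [Matrix.transpose_mul, Matrix.mul_assoc]
  refine ⟨U * Matrix.diagonal (fun i => (d i)⁻¹) * Uᵀ, keyT _, ?_⟩
  subst hA'
  constructor
  · rw [key, key]; congr 3; funext i; exact mul_inv_mul_cancel (d i)
  · rw [key, key]; congr 3; funext i; by_cases h : d i = 0 <;> simp [h]
  · rw [key, keyT]
  · rw [key, keyT]

theorem exists_isMoorePenrose {m n : Type*} [Fintype m] [Fintype n]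
    (A : Matrix m n ℝ) : ∃ B : Matrix n m ℝ, IsMoorePenrose A B := by
  classical
  have hH : (Aᵀ * A).IsHermitian := by
    simpa using Matrix.isHermitian_conjTranspose_mul_self A
  obtain ⟨B, hBs, hB⟩ := exists_isMoorePenrose_of_isHermitian hH
  have h0 : A * (B * (Aᵀ * A)) = A := by
    have h : Aᵀ * A * (B * (Aᵀ * A) - 1) = 0 := by
      rw [Matrix.mul_sub, ← Matrix.mul_assoc, hB.mul_mul_left, Matrix.mul_one, sub_self]
    have h' : A * (B * (Aᵀ * A) - 1) = 0 := by
      rw [← Matrix.conjTranspose_mul_self_mul_eq_zero]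
      simpa using h
    rw [Matrix.mul_sub, Matrix.mul_one] at h'
    exact sub_eq_zero.1 h'
  refine ⟨B * Aᵀ, ?_, ?_, ?_, ?_⟩
  · simpa only [Matrix.mul_assoc] using h0
  · have h := congrArg (fun Z => Z * Aᵀ) hB.mul_mul_right
    simpa only [Matrix.mul_assoc] using h
  · simp [Matrix.transpose_mul, hBs, Matrix.mul_assoc]
  · have h := hB.symm_right
    simpa only [Matrix.mul_assoc] using h

/-- The Moore-Penrose generalized inverse `A⁺` of a real matrix. -/
def pinv {m n : Type*} [Fintype m] [Fintype n] (A : Matrix m n ℝ) : Matrix n m ℝ :=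
  (exists_isMoorePenrose A).choose

theorem pinv_spec {m n : Type*} [Fintype m] [Fintype n] (A : Matrix m n ℝ) :
    IsMoorePenrose A (pinv A) :=
  (exists_isMoorePenrose A).choose_spec

variable {n p : ℕ}

/-- The vector `X b` as an element of Euclidean space `ℝⁿ`. -/
def meanVec (X : Matrix (Fin n) (Fin p) ℝ) (b : Fin p → ℝ) : EuclideanSpace ℝ (Fin n) :=
  WithLp.toLp 2 (X *ᵥ b)

/-- The diagonal indicator matrix `D_M` of a model (a set of predictors) `M`. -/
def indicatorMatrix (M : Finset (Fin p)) : Matrix (Fin p) (Fin p) ℝ :=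
  Matrix.diagonal (fun j => if j ∈ M then 1 else 0)

/-- The least squares estimate `(D_M X' X D_M)⁺ D_M X' y` of the coefficients in model `M`. -/
def lsEstimate (X : Matrix (Fin n) (Fin p) ℝ) (M : Finset (Fin p))
    (y : EuclideanSpace ℝ (Fin n)) : Fin p → ℝ :=
  (pinv (indicatorMatrix M * Xᵀ * X * indicatorMatrix M) * indicatorMatrix M * Xᵀ) *ᵥ
    (fun i => y i)

/-- The span in `ℝⁿ` of the predictors (columns of `X`) belonging to the model `M`. -/
def modelSpan (X : Matrix (Fin n) (Fin p) ℝ) (M : Finset (Fin p)) :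
    Submodule ℝ (EuclideanSpace ℝ (Fin n)) :=
  Submodule.span ℝ ((fun j => WithLp.toLp 2 (X.col j)) '' (M : Set (Fin p)))

/-- `X β_M`: the orthogonal projection of `X β` on the span of the model `M`. -/
def projMean (X : Matrix (Fin n) (Fin p) ℝ) (β : Fin p → ℝ) (M : Finset (Fin p)) :
    EuclideanSpace ℝ (Fin n) :=
  (modelSpan X M).starProjection (meanVec X β)

/-- A prior on the model size: a probability distribution on `{0, …, r}` charging every point,
extended by zero. -/
structure IsSizePrior (r : ℕ) (π : ℕ → ℝ) : Prop where
  pos : ∀ k ≤ r, 0 < π k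
  zero : ∀ k, r < k → π k = 0
  sum_eq_one : ∑ k ∈ Finset.range (r + 1), π k = 1

/-- The constant `c(γ) = 8 (γ + 3/4)²`. -/
def cConst (γ : ℝ) : ℝ := 8 * (γ + 3 / 4) ^ 2

/-- Assumption (P) on the prior, for `p` predictors and a design matrix of rank `r`. -/
structure AssumptionP (p r : ℕ) (γ : ℝ) (π : ℕ → ℝ) : Prop where
  lt_rank : ∀ k < r, π k ≤ (p.choose k : ℝ) * Real.exp (-(cConst γ) * k)
  at_rank : π r ≤ Real.exp (-(cConst γ) * r)

/-- The Bayesian complexity penalty. Only the sizes `k ≤ r` are admissible; at `k = r` all models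
represent the single saturated model and the binomial coefficient is absent. -/
def pen (p r : ℕ) (σ γ : ℝ) (π : ℕ → ℝ) (k : ℕ) : ℝ :=
  if k < r then
    2 * σ ^ 2 * (1 + 1 / γ) *
      Real.log ((p.choose k : ℝ) * (π k)⁻¹ * (1 + γ) ^ ((k : ℝ) / 2))
  else
    2 * σ ^ 2 * (1 + 1 / γ) * Real.log ((π k)⁻¹ * (1 + γ) ^ ((k : ℝ) / 2))

/-- The penalized least squares criterion `‖y - X β̂_M‖² + Pen(|M|)`. -/
def plsCriterion (X : Matrix (Fin n) (Fin p) ℝ) (Pen : ℕ → ℝ)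
    (y : EuclideanSpace ℝ (Fin n)) (M : Finset (Fin p)) : ℝ :=
  ‖y - meanVec X (lsEstimate X M y)‖ ^ 2 + Pen M.card

/-- `M` solves the penalized least squares problem at the data `y`. Models with more than
`rank X` predictors have prior probability zero (infinite penalty) and are not admissible. -/
def IsPLSSolution (X : Matrix (Fin n) (Fin p) ℝ) (Pen : ℕ → ℝ)
    (y : EuclideanSpace ℝ (Fin n)) (M : Finset (Fin p)) : Prop :=
  M.card ≤ X.rank ∧
    ∀ M' : Finset (Fin p), M'.card ≤ X.rank → plsCriterion X Pen y M ≤ plsCriterion X Pen y M'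

end MAPSelection

end

/-! The fitted vector of a model is the projection of the data on its span (`meanVec_lsEstimate`),
so comparing the criterion at the selected model with that at a fixed `M` leaves one dangerous term:
the inner product of the noise with `f - μ`, where `μ = X β` and `f` is the selected fit. For each
candidate model `f - μ` lies in a deterministic space, the model span enlarged by `μ`, of dimension
at most `k + 1`. Young's inequality gives a fraction `a < 1` of the loss to the left side and leaves
the excess `a⁻¹ ‖W e‖² - Pen`, with `W` the projection on that space
(`penalized_projection_oracle`).

The selected model being random, its excess is bounded through `x ≤ exp x` by a sum of exponentials
over all models. Each has a chi-square exponential moment, which the penalty turns into at most a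
constant times the prior weight of the model (`exp_neg_log_penalty_mul_le`). The weights add up to
one when the models of size `r`, which share a single span, are counted once; hence a bound free of
`n`, `p` and `r` (`integral_totalExcess_le`). -/

/-! ### Exponential moments of projected Gaussian noise. -/

theorem integrable_exp_mul_sq_gaussianReal {t : ℝ} (ht : t < 1 / 2) :
    Integrable (fun x => Real.exp (t * x ^ 2)) (gaussianReal 0 1) ∧
      ∫ x, Real.exp (t * x ^ 2) ∂gaussianReal 0 1 = (√(1 - 2 * t))⁻¹ := by
  have key : ∀ x : ℝ, gaussianPDFReal 0 1 x * Real.exp (t * x ^ 2)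
      = (√(2 * Real.pi))⁻¹ * Real.exp (-(1 / 2 - t) * x ^ 2) := by
    intro x
    rw [gaussianPDFReal_def]
    simp only [NNReal.coe_one, mul_one, sub_zero]
    rw [mul_assoc, ← Real.exp_add]
    congr 2
    ring
  constructor
  · rw [gaussianReal_of_var_ne_zero _ one_ne_zero,
      integrable_withDensity_iff_integrable_smul' (measurable_gaussianPDF 0 1)
        (ae_of_all _ fun _ => gaussianPDF_lt_top)]
    simp only [toReal_gaussianPDF, smul_eq_mul, key]
    exact (integrable_exp_neg_mul_sq (by linarith)).const_mul _
  · rw [integral_gaussianReal_eq_integral_smul one_ne_zero]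
    simp only [smul_eq_mul, key]
    rw [integral_const_mul, integral_gaussian, ← Real.sqrt_inv, ← Real.sqrt_inv,
      ← Real.sqrt_mul (by positivity)]
    congr 1
    have : 1 - 2 * t ≠ 0 := by linarith
    have : (1 / 2 - t) ≠ 0 := by linarith
    have := Real.pi_ne_zero
    field_simp

section StdGaussian

variable {E : Type*} [NormedAddCommGroup E] [InnerProductSpace ℝ E] [FiniteDimensional ℝ E]
  [MeasurableSpace E] [BorelSpace E]

theorem integrable_exp_mul_norm_sq_stdGaussian {t : ℝ} (ht : t < 1 / 2) :
    Integrable (fun x : E => Real.exp (t * ‖x‖ ^ 2)) (stdGaussian E) ∧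
      ∫ x : E, Real.exp (t * ‖x‖ ^ 2) ∂stdGaussian E
        = (√(1 - 2 * t))⁻¹ ^ Module.finrank ℝ E := by
  have key : ∀ x : Fin (Module.finrank ℝ E) → ℝ,
      Real.exp (t * ‖∑ i, x i • stdOrthonormalBasis ℝ E i‖ ^ 2)
        = ∏ i, Real.exp (t * x i ^ 2) := by
    intro x
    rw [← Real.exp_sum, ← Finset.mul_sum, ← OrthonormalBasis.sum_sq_norm_inner_right
      (stdOrthonormalBasis ℝ E)]
    congr 2
    refine Finset.sum_congr rfl fun i _ => ?_
    rw [(stdOrthonormalBasis ℝ E).orthonormal.inner_right_fintype]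
    simp
  have hm : AEMeasurable (fun x : Fin (Module.finrank ℝ E) → ℝ =>
      ∑ i, x i • stdOrthonormalBasis ℝ E i) (Measure.pi fun _ => gaussianReal 0 1) :=
    Measurable.aemeasurable (by fun_prop)
  have hc : ∀ ν : Measure E, AEStronglyMeasurable (fun x : E => Real.exp (t * ‖x‖ ^ 2)) ν :=
    fun ν => (by fun_prop : Continuous fun x : E => Real.exp (t * ‖x‖ ^ 2)).aestronglyMeasurable
  constructor
  · rw [stdGaussian, integrable_map_measure (hc _) hm]
    simp only [Function.comp_def, key]
    exact Integrable.fintype_prod (f := fun _ x => Real.exp (t * x ^ 2))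
      fun _ => (integrable_exp_mul_sq_gaussianReal ht).1
  · rw [stdGaussian, integral_map hm (hc _)]
    simp only [key]
    rw [integral_fintype_prod_eq_prod (f := fun _ x => Real.exp (t * x ^ 2))]
    simp [(integrable_exp_mul_sq_gaussianReal ht).2]

/-- Characteristic functions agree: pairing the projection of `x` with `w ∈ W` is the same as
pairing `x` with `w`. -/
theorem stdGaussian_map_orthogonalProjectionOnto (W : Submodule ℝ E) :
    (stdGaussian E).map W.orthogonalProjectionOnto = stdGaussian W := by
  apply Measure.ext_of_charFun
  ext w
  rw [charFun_apply, integral_map (by fun_prop) (by fun_prop)]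
  simp only [Submodule.inner_orthogonalProjectionOnto_eq_of_mem_right]
  rw [← charFun_apply, charFun_stdGaussian, charFun_stdGaussian]
  simp

theorem integrable_exp_mul_norm_sq_starProjection_stdGaussian (W : Submodule ℝ E) {t : ℝ}
    (ht : t < 1 / 2) :
    Integrable (fun x : E => Real.exp (t * ‖W.starProjection x‖ ^ 2)) (stdGaussian E) ∧
      ∫ x : E, Real.exp (t * ‖W.starProjection x‖ ^ 2) ∂stdGaussian E
        = (√(1 - 2 * t))⁻¹ ^ Module.finrank ℝ W := by
  have h := integrable_exp_mul_norm_sq_stdGaussian (E := W) ht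
  have hc : ∀ ν : Measure W, AEStronglyMeasurable (fun x : W => Real.exp (t * ‖x‖ ^ 2)) ν :=
    fun ν => (by fun_prop : Continuous fun x : W => Real.exp (t * ‖x‖ ^ 2)).aestronglyMeasurable
  rw [← stdGaussian_map_orthogonalProjectionOnto, integrable_map_measure (hc _) (by fun_prop),
    integral_map (by fun_prop) (hc _)] at h
  exact h

end StdGaussian

open scoped MatrixOrder in
theorem multivariateGaussian_zero_sq_smul_one {n : ℕ} {σ : ℝ} (hσ : 0 ≤ σ) :
    multivariateGaussian 0 (σ ^ 2 • (1 : Matrix (Fin n) (Fin n) ℝ))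
      = (stdGaussian (EuclideanSpace ℝ (Fin n))).map (fun x => σ • x) := by
  have h : CFC.sqrt (σ ^ 2 • (1 : Matrix (Fin n) (Fin n) ℝ)) = σ • 1 := by
    refine CFC.sqrt_unique ?_ ?_
    · simp [sq, smul_smul]
    · exact (Matrix.PosSemidef.one.smul hσ).nonneg
  rw [multivariateGaussian, h]
  congr 1
  ext x
  simp

section Noise

variable {n : ℕ} {σ : ℝ} {Ω : Type*} [MeasurableSpace Ω] {P : Measure Ω}
  {ε : Ω → EuclideanSpace ℝ (Fin n)}

theorem integrable_exp_norm_sq_starProjection_noise (hσ : 0 < σ)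
    (hε : HasLaw ε (multivariateGaussian 0 (σ ^ 2 • (1 : Matrix (Fin n) (Fin n) ℝ))) P)
    (W : Submodule ℝ (EuclideanSpace ℝ (Fin n))) {t : ℝ} (ht : t < 1 / 2) :
    Integrable (fun ω => Real.exp (t / σ ^ 2 * ‖W.starProjection (ε ω)‖ ^ 2)) P ∧
      ∫ ω, Real.exp (t / σ ^ 2 * ‖W.starProjection (ε ω)‖ ^ 2) ∂P
        = (√(1 - 2 * t))⁻¹ ^ Module.finrank ℝ W := by
  have h := integrable_exp_mul_norm_sq_starProjection_stdGaussian W ht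
  have hscale : ∀ x : EuclideanSpace ℝ (Fin n), Real.exp (t * ‖W.starProjection x‖ ^ 2)
      = Real.exp (t / σ ^ 2 * ‖W.starProjection (σ • x)‖ ^ 2) := by
    intro x
    rw [map_smul, norm_smul, mul_pow, Real.norm_eq_abs, sq_abs]
    congr 1
    field_simp
  have hc : ∀ ν : Measure (EuclideanSpace ℝ (Fin n)), AEStronglyMeasurable
      (fun x => Real.exp (t / σ ^ 2 * ‖W.starProjection x‖ ^ 2)) ν := fun ν =>
    (by fun_prop : Continuous fun x : EuclideanSpace ℝ (Fin n) =>
      Real.exp (t / σ ^ 2 * ‖W.starProjection x‖ ^ 2)).aestronglyMeasurable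
  simp only [hscale] at h
  have hm : AEMeasurable (fun x => σ • x) (stdGaussian (EuclideanSpace ℝ (Fin n))) := by
    fun_prop
  have hi := integrable_map_measure (hc _) hm
  simp only [Function.comp_def] at hi
  rw [← hi, ← integral_map hm (hc _), ← multivariateGaussian_zero_sq_smul_one hσ.le,
    ← hε.map_eq, integrable_map_measure (hc _) hε.aemeasurable,
    integral_map hε.aemeasurable (hc _)] at h
  exact h

theorem integrable_noise
    (hε : HasLaw ε (multivariateGaussian 0 (σ ^ 2 • (1 : Matrix (Fin n) (Fin n) ℝ))) P) :
    Integrable ε P ∧ ∫ ω, ε ω ∂P = 0 := by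
  constructor
  · have h := IsGaussian.integrable_id
      (μ := multivariateGaussian 0 (σ ^ 2 • (1 : Matrix (Fin n) (Fin n) ℝ)))
    rw [← hε.map_eq, integrable_map_measure (by fun_prop) hε.aemeasurable] at h
    exact h
  · have h := integral_id_multivariateGaussian
      (μ := 0) (S := (σ ^ 2 • (1 : Matrix (Fin n) (Fin n) ℝ)))
    rwa [← hε.map_eq, integral_map hε.aemeasurable (by fun_prop)] at h

end Noise

/-! ### Least squares as orthogonal projection; dimensions of model spans. -/

namespace MAPSelection

variable {n p : ℕ}

theorem toLp_mulVec_indicatorMatrix_mem_modelSpan (X : Matrix (Fin n) (Fin p) ℝ)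
    (M : Finset (Fin p)) (w : Fin p → ℝ) :
    (WithLp.toLp 2 (X *ᵥ (indicatorMatrix M *ᵥ w)) : EuclideanSpace ℝ (Fin n))
      ∈ modelSpan X M := by
  have h : (WithLp.toLp 2 (X *ᵥ (indicatorMatrix M *ᵥ w)) : EuclideanSpace ℝ (Fin n))
      = ∑ j ∈ M, w j • WithLp.toLp 2 (X.col j) := by
    ext i
    simp [indicatorMatrix, Matrix.mulVec, dotProduct,
      Matrix.diagonal_apply, Finset.sum_ite_mem, mul_comm]
  rw [h]
  exact Submodule.sum_mem _ fun j hj => Submodule.smul_mem _ _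
    (Submodule.subset_span ⟨j, hj, rfl⟩)

theorem indicatorMatrix_transpose (M : Finset (Fin p)) :
    (indicatorMatrix M)ᵀ = indicatorMatrix M := by
  simp [indicatorMatrix]

theorem indicatorMatrix_mul_self (M : Finset (Fin p)) :
    indicatorMatrix M * indicatorMatrix M = indicatorMatrix M := by
  simp [indicatorMatrix]

theorem meanVec_lsEstimate (X : Matrix (Fin n) (Fin p) ℝ) (M : Finset (Fin p))
    (y : EuclideanSpace ℝ (Fin n)) :
    meanVec X (lsEstimate X M y) = (modelSpan X M).starProjection y := by
  set D := indicatorMatrix M with hD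
  have hDT : Dᵀ = D := indicatorMatrix_transpose M
  have hDD : D * D = D := indicatorMatrix_mul_self M
  set G := D * Xᵀ * X * D with hG
  set B := pinv G with hB
  have hBG : IsMoorePenrose G B := pinv_spec G
  have hDG : D * G = G := by simp only [hG, ← Matrix.mul_assoc, hDD]
  have hGT : Gᵀ = G := by
    simp only [hG, Matrix.transpose_mul, Matrix.transpose_transpose, hDT, Matrix.mul_assoc]
  have hDB : D * B = B := by
    -- By symmetry of `B * G` and `G`, the range of `B * G` lies in that of `G`, which `D` fixes.
    have h1 : B * G = G * Bᵀ := by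
      rw [← hBG.symm_right, Matrix.transpose_mul, hGT]
    calc D * B = D * (B * G * B) := by rw [hBG.mul_mul_right]
      _ = (D * G) * Bᵀ * B := by rw [h1]; simp only [Matrix.mul_assoc]
      _ = B * G * B := by rw [hDG, h1]
      _ = B := hBG.mul_mul_right
  -- These are the normal equations. Since `G = (X D)ᴴ (X D)`, the identity `G B G = G` may be
  -- cancelled on the right down to `(X D)ᴴ = D Xᵀ`.
  have hGB : G * B * (D * Xᵀ) = D * Xᵀ := by
    have h1 : (G * B - 1) * ((X * D)ᴴ * (X * D)) = 0 := by
      have : (X * D)ᴴ * (X * D) = G := by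
        simp [hG, Matrix.conjTranspose_eq_transpose_of_trivial, hDT,
          Matrix.mul_assoc]
      rw [this, Matrix.sub_mul, hBG.mul_mul_left, Matrix.one_mul, sub_self]
    rw [Matrix.mul_conjTranspose_mul_self_eq_zero] at h1
    have h2 : (X * D)ᴴ = D * Xᵀ := by
      simp [Matrix.conjTranspose_eq_transpose_of_trivial, hDT]
    rw [h2, Matrix.sub_mul, Matrix.one_mul] at h1
    exact sub_eq_zero.1 h1
  have hls : lsEstimate X M y = D *ᵥ ((B * D * Xᵀ) *ᵥ fun i => y i) := by
    rw [Matrix.mulVec_mulVec]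
    simp only [← Matrix.mul_assoc, hDB]
    rfl
  symm
  apply Submodule.eq_starProjection_of_mem_orthogonal
  · rw [meanVec, hls]
    exact toLp_mulVec_indicatorMatrix_mem_modelSpan X M _
  · rw [modelSpan, Submodule.mem_orthogonal]
    intro u hu
    induction hu using Submodule.span_induction with
    | zero => simp
    | add a b _ _ ha hb => rw [inner_add_left, ha, hb, add_zero]
    | smul c a _ ha => rw [inner_smul_left, ha, mul_zero]
    | mem u hu =>
      obtain ⟨j, hj, rfl⟩ := hu
      have h0 : (D * Xᵀ) *ᵥ ((fun i => y i) - X *ᵥ lsEstimate X M y) = 0 := by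
        rw [Matrix.mulVec_sub, hls, Matrix.mulVec_mulVec, Matrix.mulVec_mulVec,
          Matrix.mulVec_mulVec]
        have : D * Xᵀ * X * D * (B * D * Xᵀ) = D * Xᵀ := by
          calc _ = G * B * (D * Xᵀ) := by simp only [hG, Matrix.mul_assoc]
            _ = _ := hGB
        rw [this, sub_self]
      have hj0 := congrFun h0 j
      rw [hD, indicatorMatrix, ← Matrix.mulVec_mulVec, Matrix.mulVec_diagonal,
        if_pos (Finset.mem_coe.1 hj), one_mul] at hj0
      rw [← hj0.trans (Pi.zero_apply j)]
      simp [PiLp.inner_apply, meanVec, Matrix.mulVec, dotProduct, mul_comm]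

theorem finrank_modelSpan_le (X : Matrix (Fin n) (Fin p) ℝ) (M : Finset (Fin p)) :
    Module.finrank ℝ (modelSpan X M) ≤ M.card := by
  classical
  rw [modelSpan, ← Finset.coe_image]
  exact (finrank_span_finset_le_card _).trans Finset.card_image_le

theorem modelSpan_eq_map (X : Matrix (Fin n) (Fin p) ℝ) (M : Finset (Fin p)) :
    modelSpan X M = (Submodule.span ℝ (X.col '' (M : Set (Fin p)))).map
      (WithLp.linearEquiv 2 ℝ (Fin n → ℝ)).symm.toLinearMap := by
  rw [modelSpan, Submodule.map_span, Set.image_image]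
  rfl

theorem finrank_modelSpan_univ (X : Matrix (Fin n) (Fin p) ℝ) :
    Module.finrank ℝ (modelSpan X Finset.univ) = X.rank := by
  rw [modelSpan_eq_map, LinearEquiv.finrank_map_eq, Matrix.rank_eq_finrank_span_cols,
    Finset.coe_univ, Set.image_univ]

theorem modelSpan_mono (X : Matrix (Fin n) (Fin p) ℝ) {M M' : Finset (Fin p)} (h : M ⊆ M') :
    modelSpan X M ≤ modelSpan X M' :=
  Submodule.span_mono (Set.image_mono (Finset.coe_subset.2 h))

/-- This is what allows the penalty at size `r` to omit the binomial coefficient: all these models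
are one model. -/
theorem modelSpan_eq_univ_of_linearIndependent (X : Matrix (Fin n) (Fin p) ℝ)
    {M : Finset (Fin p)} (hM : M.card = X.rank)
    (hli : LinearIndependent ℝ (fun j : M => X.col (j : Fin p))) :
    modelSpan X M = modelSpan X Finset.univ := by
  apply Submodule.eq_of_le_of_finrank_eq (modelSpan_mono X (Finset.subset_univ M))
  rw [finrank_modelSpan_univ, modelSpan_eq_map, LinearEquiv.finrank_map_eq, ← hM]
  have h := finrank_span_eq_card hli
  rw [Fintype.card_coe] at h
  rw [← h, Set.image_eq_range]
  rfl

/-- The span of the model `M` enlarged by the direction of the vector `v`. -/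
noncomputable def extendedSpan (X : Matrix (Fin n) (Fin p) ℝ) (v : EuclideanSpace ℝ (Fin n))
    (M : Finset (Fin p)) : Submodule ℝ (EuclideanSpace ℝ (Fin n)) :=
  modelSpan X M ⊔ Submodule.span ℝ {v}

theorem finrank_extendedSpan_le (X : Matrix (Fin n) (Fin p) ℝ) (v : EuclideanSpace ℝ (Fin n))
    (M : Finset (Fin p)) :
    Module.finrank ℝ (extendedSpan X v M) ≤ Module.finrank ℝ (modelSpan X M) + 1 := by
  refine (Submodule.finrank_add_le_finrank_add_finrank _ _).trans ?_
  gcongr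
  simpa using finrank_span_le_card (R := ℝ) ({v} : Set (EuclideanSpace ℝ (Fin n)))

theorem norm_sub_starProjection_le {E : Type*} [NormedAddCommGroup E] [InnerProductSpace ℝ E]
    (S : Submodule ℝ E) [S.HasOrthogonalProjection] (y : E) {v : E} (hv : v ∈ S) :
    ‖y - S.starProjection y‖ ≤ ‖y - v‖ := by
  rw [S.starProjection_minimal]
  exact ciInf_le ⟨0, by rintro _ ⟨w, rfl⟩; positivity⟩ (⟨v, hv⟩ : S)

/-- The oracle inequality satisfied pointwise by a penalized projection estimator. -/
theorem penalized_projection_oracle {E : Type*} [NormedAddCommGroup E] [InnerProductSpace ℝ E]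
    (S T W : Submodule ℝ E) [S.HasOrthogonalProjection] [T.HasOrthogonalProjection]
    [W.HasOrthogonalProjection] {μ e : E} (hTW : T ≤ W) (hμ : μ ∈ W) {a b c : ℝ} (ha : 0 < a)
    (h : ‖μ + e - T.starProjection (μ + e)‖ ^ 2 + b
      ≤ ‖μ + e - S.starProjection (μ + e)‖ ^ 2 + c) :
    (1 - a) * ‖T.starProjection (μ + e) - μ‖ ^ 2
      ≤ ‖S.starProjection μ - μ‖ ^ 2 + c + 2 * inner ℝ (μ - S.starProjection μ) e
        + (a⁻¹ * ‖W.starProjection e‖ ^ 2 - b) := by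
  have h1 : ‖μ + e - S.starProjection (μ + e)‖ ^ 2 ≤ ‖μ + e - S.starProjection μ‖ ^ 2 := by
    gcongr
    exact norm_sub_starProjection_le S _ (S.starProjection_apply_mem μ)
  set f := T.starProjection (μ + e) with hf
  have hfW : f - μ ∈ W := W.sub_mem (hTW (T.starProjection_apply_mem _)) hμ
  have e1 : ‖μ + e - f‖ ^ 2 = ‖f - μ‖ ^ 2 - 2 * inner ℝ (f - μ) e + ‖e‖ ^ 2 := by
    rw [show μ + e - f = e - (f - μ) by abel, norm_sub_sq_real, real_inner_comm]
    ring
  have e2 : ‖μ + e - S.starProjection μ‖ ^ 2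
      = ‖S.starProjection μ - μ‖ ^ 2 + 2 * inner ℝ (μ - S.starProjection μ) e + ‖e‖ ^ 2 := by
    rw [show μ + e - S.starProjection μ = (μ - S.starProjection μ) + e by abel,
      norm_add_sq_real, norm_sub_rev]
  -- As `f - μ` lies in `W`, only the component of the noise in `W` counts.
  have e3 : inner ℝ (f - μ) e ≤ ‖f - μ‖ * ‖W.starProjection e‖ := by
    have : inner ℝ (f - μ) e = inner ℝ (f - μ) (W.starProjection e) := by
      rw [← Submodule.inner_starProjection_left_eq_right,
        Submodule.starProjection_eq_self_iff.2 hfW]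
    rw [this]
    exact real_inner_le_norm _ _
  have e4 : 2 * (‖f - μ‖ * ‖W.starProjection e‖)
      ≤ a * ‖f - μ‖ ^ 2 + a⁻¹ * ‖W.starProjection e‖ ^ 2 := by
    have := mul_nonneg ha.le (sq_nonneg (‖f - μ‖ - a⁻¹ * ‖W.starProjection e‖))
    have h2 : a * (‖f - μ‖ - a⁻¹ * ‖W.starProjection e‖) ^ 2
        = a * ‖f - μ‖ ^ 2 - 2 * (‖f - μ‖ * ‖W.starProjection e‖)
          + a⁻¹ * ‖W.starProjection e‖ ^ 2 := by
      field_simp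
      ring
    linarith
  linarith

end MAPSelection

/-! ### The penalty against the chi-square moments. -/

namespace MAPSelection

/-- The weight `π(k) / C(p, k)` that the prior gives to one model of size `k`, the models of
full size `r` being identified with each other. -/
noncomputable def modelWeight (p r : ℕ) (π : ℕ → ℝ) (k : ℕ) : ℝ :=
  if k < r then π k / p.choose k else π k

theorem pen_eq_log_modelWeight (p r : ℕ) (σ γ : ℝ) (π : ℕ → ℝ) (k : ℕ) :
    pen p r σ γ π k = 2 * σ ^ 2 * (1 + 1 / γ) *
      Real.log ((modelWeight p r π k)⁻¹ * (1 + γ) ^ ((k : ℝ) / 2)) := by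
  unfold pen modelWeight
  split_ifs
  · rw [inv_div, ← div_eq_mul_inv]
  · rfl

theorem modelWeight_pos {p r : ℕ} {π : ℕ → ℝ} (hπ : IsSizePrior r π) (hrp : r ≤ p) {k : ℕ}
    (hk : k ≤ r) : 0 < modelWeight p r π k := by
  have := hπ.pos k hk
  unfold modelWeight
  split_ifs
  · have := Nat.choose_pos (hk.trans hrp)
    positivity
  · exact this

theorem modelWeight_le {p r : ℕ} {γ : ℝ} {π : ℕ → ℝ} (hP : AssumptionP p r γ π)
    (hrp : r ≤ p) {k : ℕ} (hk : k ≤ r) :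
    modelWeight p r π k ≤ Real.exp (-(cConst γ) * k) := by
  unfold modelWeight
  split_ifs with h
  · have : (0 : ℝ) < p.choose k := by exact_mod_cast Nat.choose_pos (hk.trans hrp)
    rw [div_le_iff₀' this]
    exact hP.lt_rank k h
  · obtain rfl : k = r := by omega
    exact hP.at_rank

/-- The `C(p, k)` models of size `k < r` share the mass `π k` equally, and the saturated model
carries `π r`. -/
theorem sum_modelWeight {p r : ℕ} {π : ℕ → ℝ} (hπ : IsSizePrior r π) (hrp : r ≤ p) :
    ∑ M : Finset (Fin p) with M.card < r, modelWeight p r π M.card + modelWeight p r π r = 1 := by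
  rw [← hπ.sum_eq_one, Finset.sum_range_succ]
  congr 1
  · rw [← Finset.sum_fiberwise_of_maps_to (t := Finset.range r) (g := Finset.card)
      (by simp)]
    refine Finset.sum_congr rfl fun k hk => ?_
    have hk := Finset.mem_range.1 hk
    have hset : Finset.filter (fun M : Finset (Fin p) => M.card = k)
        (Finset.univ.filter fun M : Finset (Fin p) => M.card < r)
        = Finset.powersetCard k Finset.univ := by
      ext M
      simp only [Finset.mem_filter, Finset.mem_univ, true_and, Finset.mem_powersetCard,
        Finset.subset_univ]
      omega
    rw [hset, Finset.sum_congr rfl (g := fun _ => π k / p.choose k), Finset.sum_const,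
      Finset.card_powersetCard, Finset.card_univ, Fintype.card_fin, nsmul_eq_mul]
    · have : (p.choose k : ℝ) ≠ 0 := by
        exact_mod_cast (Nat.choose_pos (hk.le.trans hrp)).ne'
      field_simp
    · intro M hM
      rw [(Finset.mem_powersetCard.1 hM).2, modelWeight, if_pos hk]
  · simp [modelWeight]

/-- A penalty of Bayesian type dominates the exponential moment of a chi-square variable with at
most `k + 1` degrees of freedom. -/
theorem exp_neg_log_penalty_mul_le {γ w : ℝ} (hγ : 0 < γ) (hw : 0 < w) {k d : ℕ}
    (hwk : w ≤ Real.exp (-(cConst γ) * k)) (hd : d ≤ k + 1) :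
    Real.exp (-((1 + 1 / (4 * γ)) * Real.log (w⁻¹ * (1 + γ) ^ ((k : ℝ) / 2))))
      * √(2 * (1 + γ)) ^ d ≤ w * √(2 * (1 + γ)) := by
  have hg : 0 < 1 + γ := by linarith
  have hs : (1 + γ) ^ ((k : ℝ) / 2) = √(1 + γ) ^ k := by
    rw [Real.sqrt_eq_rpow, ← Real.rpow_natCast, ← Real.rpow_mul hg.le]
    congr 1
    ring
  rw [hs]
  have hs1 : 1 ≤ √(1 + γ) := Real.one_le_sqrt.2 (by linarith)
  set s := √(1 + γ) with hsdef
  have hs0 : 0 < s := by linarith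
  have hq : √(2 * (1 + γ)) = √2 * s := Real.sqrt_mul (by norm_num) _
  have hq1 : 1 ≤ √2 * s := one_le_mul_of_one_le_of_one_le (Real.one_le_sqrt.2 (by norm_num)) hs1
  rw [hq]
  have hx : 0 < w⁻¹ * s ^ k := by positivity
  have hlog : cConst γ * k ≤ Real.log (w⁻¹ * s ^ k) := by
    rw [Real.le_log_iff_exp_le hx]
    calc Real.exp (cConst γ * k) = (Real.exp (-(cConst γ) * k))⁻¹ := by
          rw [← Real.exp_neg]; congr 1; ring
      _ ≤ w⁻¹ := by gcongr
      _ ≤ w⁻¹ * s ^ k := le_mul_of_one_le_right (by positivity) (one_le_pow₀ hs1)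
  -- From `(γ - 3/4)² ≥ 0` follows `(γ + 3/4)² ≥ 3γ`, so there is room to spare.
  have hc : 1 ≤ 1 / (4 * γ) * cConst γ := by
    rw [cConst, one_div_mul_eq_div, le_div_iff₀ (by positivity)]
    nlinarith [sq_nonneg (γ - 3 / 4)]
  have h1 : (k : ℝ) ≤ 1 / (4 * γ) * Real.log (w⁻¹ * s ^ k) := by
    calc (k : ℝ) ≤ 1 / (4 * γ) * cConst γ * k := le_mul_of_one_le_left (by positivity) hc
      _ = 1 / (4 * γ) * (cConst γ * k) := by ring
      _ ≤ _ := by gcongr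
  -- The first power of the logarithm restores `w` and cancels `s ^ k`; the surplus `1 / (4γ)`
  -- yields `exp (-k)`, which absorbs the factor `√2 ^ k` of the chi-square moment. The additional
  -- degree of freedom leaves the single factor `√2 * s`.
  have h2 : Real.exp (-((1 + 1 / (4 * γ)) * Real.log (w⁻¹ * s ^ k)))
      ≤ w * (s ^ k)⁻¹ * Real.exp (-1) ^ k := by
    rw [← Real.exp_nat_mul]
    have : w * (s ^ k)⁻¹ = Real.exp (-Real.log (w⁻¹ * s ^ k)) := by
      rw [Real.exp_neg, Real.exp_log hx, mul_inv, inv_inv]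
    rw [this, ← Real.exp_add, Real.exp_le_exp]
    linarith
  have h3 : √2 * Real.exp (-1) ≤ 1 := by
    rw [Real.exp_neg, ← div_eq_mul_inv, div_le_one (Real.exp_pos 1)]
    calc √2 ≤ 2 := by
          rw [Real.sqrt_le_left (by norm_num)]; norm_num
      _ ≤ Real.exp 1 := by linarith [Real.add_one_le_exp 1]
  calc Real.exp (-((1 + 1 / (4 * γ)) * Real.log (w⁻¹ * s ^ k))) * (√2 * s) ^ d
      ≤ w * (s ^ k)⁻¹ * Real.exp (-1) ^ k * (√2 * s) ^ (k + 1) := by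
        gcongr
    _ = w * (√2 * s) * (√2 * Real.exp (-1)) ^ k := by
        rw [pow_succ, mul_pow, mul_pow]
        field_simp
    _ ≤ w * (√2 * s) := mul_le_of_le_one_right (by positivity) (pow_le_one₀ (by positivity) h3)

/-- The constant `a(γ)`: the risk retained in the pointwise oracle inequality is the fraction
`1 - a(γ)`. -/
noncomputable def splitConst (γ : ℝ) : ℝ := (4 * γ + 1) / (4 * γ + 2)

/-- The order `t(γ) < 1 / 2` of the exponential moment of the chi-square variables. -/
noncomputable def momentOrder (γ : ℝ) : ℝ := (1 + 2 * γ) / (4 * (1 + γ))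

theorem splitConst_pos {γ : ℝ} (hγ : 0 < γ) : 0 < splitConst γ := by
  unfold splitConst; positivity

theorem momentOrder_pos {γ : ℝ} (hγ : 0 < γ) : 0 < momentOrder γ := by
  unfold momentOrder; positivity

theorem momentOrder_lt {γ : ℝ} (hγ : 0 < γ) : momentOrder γ < 1 / 2 := by
  unfold momentOrder
  rw [div_lt_div_iff₀ (by positivity) (by norm_num)]
  linarith

theorem inv_sqrt_one_sub_momentOrder {γ : ℝ} (hγ : 0 < γ) :
    (√(1 - 2 * momentOrder γ))⁻¹ = √(2 * (1 + γ)) := by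
  rw [← Real.sqrt_inv]
  congr 1
  have h : 1 - 2 * momentOrder γ = (2 * (1 + γ))⁻¹ := by
    unfold momentOrder
    field_simp
    ring
  rw [h, inv_inv]

/-! ### Expected excess of the noise over the penalty. -/

variable {n p : ℕ}

/-- The exponentiated excess, in the direction `v`, of the noise `e` over the penalty `b` on the
model `M`. -/
noncomputable def expExcess (X : Matrix (Fin n) (Fin p) ℝ) (v : EuclideanSpace ℝ (Fin n))
    (γ σ : ℝ) (M : Finset (Fin p)) (b : ℝ) (e : EuclideanSpace ℝ (Fin n)) : ℝ :=
  Real.exp (momentOrder γ * splitConst γ / σ ^ 2 *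
    ((splitConst γ)⁻¹ * ‖(extendedSpan X v M).starProjection e‖ ^ 2 - b))

theorem integral_expExcess_le {X : Matrix (Fin n) (Fin p) ℝ} (v : EuclideanSpace ℝ (Fin n))
    {γ σ : ℝ} (hγ : 0 < γ) (hσ : 0 < σ) {π : ℕ → ℝ} (hπ : IsSizePrior X.rank π)
    (hP : AssumptionP p X.rank γ π) {Ω : Type*} [MeasurableSpace Ω] {P : Measure Ω}
    {ε : Ω → EuclideanSpace ℝ (Fin n)}
    (hε : HasLaw ε (multivariateGaussian 0 (σ ^ 2 • (1 : Matrix (Fin n) (Fin n) ℝ))) P)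
    (M : Finset (Fin p)) {k : ℕ} (hk : k ≤ X.rank)
    (hM : Module.finrank ℝ (modelSpan X M) ≤ k) :
    Integrable (fun ω => expExcess X v γ σ M (pen p X.rank σ γ π k) (ε ω)) P ∧
      ∫ ω, expExcess X v γ σ M (pen p X.rank σ γ π k) (ε ω) ∂P
        ≤ modelWeight p X.rank π k * √(2 * (1 + γ)) := by
  have hrp : X.rank ≤ p := by simpa using X.rank_le_card_width
  obtain ⟨h1, h2⟩ := integrable_exp_norm_sq_starProjection_noise hσ hε (extendedSpan X v M)
    (momentOrder_lt hγ)
  have ha := splitConst_pos hγ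
  have hsplit : ∀ ω, expExcess X v γ σ M (pen p X.rank σ γ π k) (ε ω)
      = Real.exp (-((1 + 1 / (4 * γ)) *
          Real.log ((modelWeight p X.rank π k)⁻¹ * (1 + γ) ^ ((k : ℝ) / 2)))) *
        Real.exp (momentOrder γ / σ ^ 2 *
          ‖(extendedSpan X v M).starProjection (ε ω)‖ ^ 2) := by
    intro ω
    rw [expExcess, ← Real.exp_add, pen_eq_log_modelWeight]
    congr 1
    -- The two constants are tuned here: `momentOrder γ * splitConst γ = (4γ + 1) / (8 (1 + γ))`, so
    -- the exponent of the prior weight exceeds one by exactly `1 / (4γ)`.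
    have e1 : momentOrder γ * splitConst γ / σ ^ 2 * (2 * σ ^ 2 * (1 + 1 / γ))
        = 1 + 1 / (4 * γ) := by
      unfold momentOrder splitConst
      field_simp
      ring
    have e2 : momentOrder γ * splitConst γ / σ ^ 2 * (splitConst γ)⁻¹
        = momentOrder γ / σ ^ 2 := by
      field_simp
    rw [mul_sub, ← mul_assoc, e2, ← mul_assoc, e1]
    ring
  simp only [hsplit]
  refine ⟨h1.const_mul _, ?_⟩
  rw [integral_const_mul, h2, inv_sqrt_one_sub_momentOrder hγ]
  exact exp_neg_log_penalty_mul_le hγ (modelWeight_pos hπ hrp hk) (modelWeight_le hP hrp hk)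
    ((finrank_extendedSpan_le X v M).trans (by gcongr))

/-- The sum of the exponentiated excesses over all distinct models. -/
noncomputable def totalExcess (X : Matrix (Fin n) (Fin p) ℝ) (v : EuclideanSpace ℝ (Fin n))
    (γ σ : ℝ) (Pen : ℕ → ℝ) (e : EuclideanSpace ℝ (Fin n)) : ℝ :=
  ∑ M : Finset (Fin p) with M.card < X.rank, expExcess X v γ σ M (Pen M.card) e
    + expExcess X v γ σ Finset.univ (Pen X.rank) e

theorem integral_totalExcess_le {X : Matrix (Fin n) (Fin p) ℝ} (v : EuclideanSpace ℝ (Fin n))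
    {γ σ : ℝ} (hγ : 0 < γ) (hσ : 0 < σ) {π : ℕ → ℝ} (hπ : IsSizePrior X.rank π)
    (hP : AssumptionP p X.rank γ π) {Ω : Type*} [MeasurableSpace Ω] {P : Measure Ω}
    {ε : Ω → EuclideanSpace ℝ (Fin n)}
    (hε : HasLaw ε (multivariateGaussian 0 (σ ^ 2 • (1 : Matrix (Fin n) (Fin n) ℝ))) P) :
    Integrable (fun ω => totalExcess X v γ σ (pen p X.rank σ γ π) (ε ω)) P ∧
      ∫ ω, totalExcess X v γ σ (pen p X.rank σ γ π) (ε ω) ∂P ≤ √(2 * (1 + γ)) := by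
  have hrp : X.rank ≤ p := by simpa using X.rank_le_card_width
  have hsmall : ∀ M ∈ Finset.univ.filter fun M : Finset (Fin p) => M.card < X.rank, _ :=
    fun M hM => integral_expExcess_le v hγ hσ hπ hP hε M (Finset.mem_filter.1 hM).2.le
      (finrank_modelSpan_le X M)
  -- The set of all predictors stands for the saturated model: its cardinality may exceed the rank,
  -- but its span has dimension equal to the rank.
  have hfull := integral_expExcess_le v hγ hσ hπ hP hε Finset.univ le_rfl
    (finrank_modelSpan_univ X).le
  have hint := integrable_finsetSum _ fun M hM => (hsmall M hM).1
  unfold totalExcess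
  refine ⟨hint.add hfull.1, ?_⟩
  rw [integral_add hint hfull.1, integral_finsetSum _ fun M hM => (hsmall M hM).1]
  calc _ ≤ ∑ M : Finset (Fin p) with M.card < X.rank,
          modelWeight p X.rank π M.card * √(2 * (1 + γ))
        + modelWeight p X.rank π X.rank * √(2 * (1 + γ)) :=
        add_le_add (Finset.sum_le_sum fun M hM => (hsmall M hM).2) hfull.2
    _ = √(2 * (1 + γ)) := by
        rw [← Finset.sum_mul, ← add_mul, sum_modelWeight hπ hrp, one_mul]

/-- A model below full size is itself a term of the sum; one of full size has the same span as all
the columns and so equals the last term. -/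
theorem expExcess_le_totalExcess {X : Matrix (Fin n) (Fin p) ℝ}
    (hX : ∀ S : Finset (Fin p), S.card = X.rank →
      LinearIndependent ℝ (fun j : S => X.col (j : Fin p)))
    (v : EuclideanSpace ℝ (Fin n)) (γ σ : ℝ) (Pen : ℕ → ℝ) {M : Finset (Fin p)}
    (hM : M.card ≤ X.rank) (e : EuclideanSpace ℝ (Fin n)) :
    expExcess X v γ σ M (Pen M.card) e ≤ totalExcess X v γ σ Pen e := by
  have hnn : ∀ M b, 0 ≤ expExcess X v γ σ M b e := fun _ _ => (Real.exp_pos _).le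
  rcases hM.lt_or_eq with h | h
  · refine le_trans ?_ (le_add_of_nonneg_right (hnn _ _))
    exact Finset.single_le_sum (f := fun M => expExcess X v γ σ M (Pen M.card) e)
      (fun M _ => hnn _ _) (by simpa using h)
  · refine le_trans (le_of_eq ?_) (le_add_of_nonneg_left (Finset.sum_nonneg fun M _ => hnn _ _))
    simp only [expExcess, extendedSpan,
      modelSpan_eq_univ_of_linearIndependent X h (hX M h), h]

/-! ### Oracle inequality, pointwise and in expectation. -/

/-- The pointwise oracle inequality for the penalized least squares estimator. -/
theorem IsPLSSolution.oracle {X : Matrix (Fin n) (Fin p) ℝ}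
    (hX : ∀ S : Finset (Fin p), S.card = X.rank →
      LinearIndependent ℝ (fun j : S => X.col (j : Fin p)))
    (β : Fin p → ℝ) {γ σ : ℝ} (hγ : 0 < γ) (hσ : 0 < σ) {Pen : ℕ → ℝ}
    {e : EuclideanSpace ℝ (Fin n)} {Mhat : Finset (Fin p)}
    (hMhat : IsPLSSolution X Pen (meanVec X β + e) Mhat) {M : Finset (Fin p)}
    (hM : M.card ≤ X.rank) :
    ‖meanVec X (lsEstimate X Mhat (meanVec X β + e)) - meanVec X β‖ ^ 2
      ≤ (4 * γ + 2) * (‖projMean X β M - meanVec X β‖ ^ 2 + Pen M.card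
        + 2 * inner ℝ (meanVec X β - projMean X β M) e
        + σ ^ 2 / (momentOrder γ * splitConst γ) * totalExcess X (meanVec X β) γ σ Pen e) := by
  obtain ⟨hcard, hmin⟩ := hMhat
  have h := hmin M hM
  simp only [plsCriterion, meanVec_lsEstimate] at h
  rw [meanVec_lsEstimate]
  have ha := splitConst_pos hγ
  have ht := momentOrder_pos hγ
  have hmem : meanVec X β ∈ extendedSpan X (meanVec X β) Mhat :=
    Submodule.mem_sup_right (Submodule.mem_span_singleton_self _)
  have key := penalized_projection_oracle (modelSpan X M) (modelSpan X Mhat)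
    (extendedSpan X (meanVec X β) Mhat) le_sup_left hmem ha h
  -- With `x` the excess multiplied by `momentOrder γ * splitConst γ / σ ^ 2`, this is `x ≤ x + 1 ≤
  -- exp x`, followed by the bound of one term by the sum, which no longer depends on the selected
  -- model.
  have hz : (splitConst γ)⁻¹ * ‖(extendedSpan X (meanVec X β) Mhat).starProjection e‖ ^ 2
      - Pen Mhat.card ≤ σ ^ 2 / (momentOrder γ * splitConst γ) *
        totalExcess X (meanVec X β) γ σ Pen e := by
    rw [← inv_div, le_inv_mul_iff₀ (by positivity)]
    refine le_trans ?_ (expExcess_le_totalExcess hX (meanVec X β) γ σ Pen hcard e)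
    exact (le_add_of_nonneg_right zero_le_one).trans (Real.add_one_le_exp _)
  have h1a : 1 - splitConst γ = (4 * γ + 2)⁻¹ := by
    unfold splitConst
    field_simp
    ring
  rw [h1a, inv_mul_le_iff₀ (by positivity)] at key
  refine key.trans ?_
  unfold projMean
  gcongr

/-- The selector takes finitely many values, and on each of its level sets the loss is a continuous
function of the data. -/
theorem aestronglyMeasurable_loss (X : Matrix (Fin n) (Fin p) ℝ) (v : EuclideanSpace ℝ (Fin n))
    {Ω : Type*} [MeasurableSpace Ω] {P : Measure Ω} {y : Ω → EuclideanSpace ℝ (Fin n)}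
    (hy : AEMeasurable y P) {Mhat : Ω → Finset (Fin p)} (hM : Measurable Mhat) :
    AEStronglyMeasurable
      (fun ω => ‖meanVec X (lsEstimate X (Mhat ω) (y ω)) - v‖ ^ 2) P := by
  have h : (fun ω => ‖meanVec X (lsEstimate X (Mhat ω) (y ω)) - v‖ ^ 2)
      = fun ω => ∑ M : Finset (Fin p), (Mhat ⁻¹' {M}).indicator
        (fun ω => ‖(modelSpan X M).starProjection (y ω) - v‖ ^ 2) ω := by
    ext ω
    rw [Finset.sum_eq_single (Mhat ω), Set.indicator_of_mem (show ω ∈ Mhat ⁻¹' {Mhat ω} from rfl),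
      meanVec_lsEstimate]
    · exact fun M _ hne => Set.indicator_of_notMem (fun h => hne h.symm) _
    · simp
  rw [h]
  refine Finset.aestronglyMeasurable_fun_sum _ fun M _ => ?_
  refine AEStronglyMeasurable.indicator ?_ (hM (measurableSet_singleton M))
  have : AEMeasurable (fun ω => ‖(modelSpan X M).starProjection (y ω) - v‖ ^ 2) P := by
    fun_prop
  exact this.aestronglyMeasurable

/-- The oracle risk bound for the penalized least squares estimator, against a fixed model. -/
theorem risk_le {X : Matrix (Fin n) (Fin p) ℝ}
    (hX : ∀ S : Finset (Fin p), S.card = X.rank →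
      LinearIndependent ℝ (fun j : S => X.col (j : Fin p)))
    (β : Fin p → ℝ) {γ σ : ℝ} (hγ : 0 < γ) (hσ : 0 < σ) {π : ℕ → ℝ}
    (hπ : IsSizePrior X.rank π) (hP : AssumptionP p X.rank γ π)
    {Ω : Type*} [MeasurableSpace Ω] {P : Measure Ω} [IsProbabilityMeasure P]
    {ε : Ω → EuclideanSpace ℝ (Fin n)}
    (hε : HasLaw ε (multivariateGaussian 0 (σ ^ 2 • (1 : Matrix (Fin n) (Fin n) ℝ))) P)
    {Mhat : Ω → Finset (Fin p)} (hMmeas : Measurable Mhat)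
    (hMhat : ∀ ω, IsPLSSolution X (pen p X.rank σ γ π) (meanVec X β + ε ω) (Mhat ω))
    {M : Finset (Fin p)} (hM : M.card ≤ X.rank) :
    Integrable (fun ω => ‖meanVec X (lsEstimate X (Mhat ω) (meanVec X β + ε ω))
        - meanVec X β‖ ^ 2) P ∧
      ∫ ω, ‖meanVec X (lsEstimate X (Mhat ω) (meanVec X β + ε ω)) - meanVec X β‖ ^ 2 ∂P
        ≤ (4 * γ + 2) * (‖projMean X β M - meanVec X β‖ ^ 2 + pen p X.rank σ γ π M.card)
          + (4 * γ + 2) * √(2 * (1 + γ)) / (momentOrder γ * splitConst γ) * σ ^ 2 := by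
  have ha := splitConst_pos hγ
  have ht := momentOrder_pos hγ
  obtain ⟨hεi, hε0⟩ := integrable_noise hε
  obtain ⟨hGi, hG⟩ := integral_totalExcess_le (meanVec X β) hγ hσ hπ hP hε
  have hpt := fun ω => (hMhat ω).oracle hX β hγ hσ hM
  have hin : Integrable
      (fun ω => 2 * inner ℝ (meanVec X β - projMean X β M) (ε ω)) P :=
    (hεi.const_inner _).const_mul _
  -- The reference model `M` is not random, so this cross term is linear in centred noise.
  have hin0 : ∫ ω, 2 * inner ℝ (meanVec X β - projMean X β M) (ε ω) ∂P = 0 := by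
    rw [integral_const_mul, integral_inner hεi, hε0, inner_zero_right, mul_zero]
  have hsum := ((integrable_const (‖projMean X β M - meanVec X β‖ ^ 2
    + pen p X.rank σ γ π M.card)).add hin).add
      (hGi.const_mul (σ ^ 2 / (momentOrder γ * splitConst γ)))
  have hbound := hsum.const_mul (4 * γ + 2)
  have hloss : Integrable (fun ω => ‖meanVec X (lsEstimate X (Mhat ω) (meanVec X β + ε ω))
      - meanVec X β‖ ^ 2) P := by
    refine hbound.mono' (aestronglyMeasurable_loss X _
      (hε.aemeasurable.const_add _) hMmeas) (ae_of_all _ fun ω => ?_)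
    rw [Real.norm_of_nonneg (by positivity)]
    exact hpt ω
  refine ⟨hloss, (integral_mono hloss hbound hpt).trans ?_⟩
  rw [integral_const_mul, integral_add' ((integrable_const _).add hin) (hGi.const_mul _),
    integral_add' (integrable_const _) hin, hin0, integral_const_mul, integral_const,
    probReal_univ, one_smul, add_zero]
  calc _ ≤ (4 * γ + 2) * (‖projMean X β M - meanVec X β‖ ^ 2 + pen p X.rank σ γ π M.card
          + σ ^ 2 / (momentOrder γ * splitConst γ) * √(2 * (1 + γ))) := by
        gcongr
    _ = _ := by ring

end MAPSelection

theorem theorem1 :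
    ∃ c₀ c₁ : ℝ → ℝ, ∀ γ : ℝ, 0 < γ → 0 < c₀ γ ∧ 0 < c₁ γ ∧
      ∀ (n p : ℕ) (X : Matrix (Fin n) (Fin p) ℝ)
        (_hX : ∀ S : Finset (Fin p), S.card = X.rank →
          LinearIndependent ℝ (fun j : S => X.col (j : Fin p)))
        (β : Fin p → ℝ) (σ : ℝ) (_hσ : 0 < σ)
        (π : ℕ → ℝ) (_hπ : MAPSelection.IsSizePrior X.rank π)
        (_hP : MAPSelection.AssumptionP p X.rank γ π)
        {Ω : Type*} [MeasurableSpace Ω] (P : Measure Ω) [IsProbabilityMeasure P]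
        (ε : Ω → EuclideanSpace ℝ (Fin n))
        (_hε : HasLaw ε (multivariateGaussian 0 (σ ^ 2 • (1 : Matrix (Fin n) (Fin n) ℝ))) P)
        (y : Ω → EuclideanSpace ℝ (Fin n))
        (_hy : ∀ ω, y ω = MAPSelection.meanVec X β + ε ω)
        (Mhat : Ω → Finset (Fin p)) (_hMmeas : Measurable Mhat)
        (_hM : ∀ ω, MAPSelection.IsPLSSolution X
          (MAPSelection.pen p X.rank σ γ π) (y ω) (Mhat ω)),
        Integrable (fun ω => ‖MAPSelection.meanVec X
            (MAPSelection.lsEstimate X (Mhat ω) (y ω)) - MAPSelection.meanVec X β‖ ^ 2) P ∧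
        ∫ ω, ‖MAPSelection.meanVec X
            (MAPSelection.lsEstimate X (Mhat ω) (y ω)) - MAPSelection.meanVec X β‖ ^ 2 ∂P
          ≤ c₀ γ * (⨅ M : {M : Finset (Fin p) // M.card ≤ X.rank},
              (‖MAPSelection.projMean X β M - MAPSelection.meanVec X β‖ ^ 2
                + MAPSelection.pen p X.rank σ γ π (M : Finset (Fin p)).card))
            + c₁ γ * σ ^ 2 := by
  -- The factor `4γ + 2` is `1 / (1 - splitConst γ)`, and `√(2 (1 + γ))` bounds the expected total
  -- excess.
  refine ⟨fun γ => 4 * γ + 2, fun γ => (4 * γ + 2) * √(2 * (1 + γ)) /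
    (MAPSelection.momentOrder γ * MAPSelection.splitConst γ), fun γ hγ => ?_⟩
  have ha := MAPSelection.splitConst_pos hγ
  have ht := MAPSelection.momentOrder_pos hγ
  refine ⟨by positivity, by positivity, ?_⟩
  intro n p X hX β σ hσ π hπ hP Ω _ P _ ε hε y hy Mhat hMmeas hM
  obtain rfl : y = fun ω => MAPSelection.meanVec X β + ε ω := funext hy
  have : Nonempty {M : Finset (Fin p) // M.card ≤ X.rank} := ⟨⟨∅, by simp⟩⟩
  -- Finitely many models are admissible, so the infimum is attained and the bound for a fixed model
  -- suffices.
  obtain ⟨M, hMinf⟩ := exists_eq_ciInf_of_finite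
    (f := fun M : {M : Finset (Fin p) // M.card ≤ X.rank} =>
      ‖MAPSelection.projMean X β M - MAPSelection.meanVec X β‖ ^ 2
        + MAPSelection.pen p X.rank σ γ π (M : Finset (Fin p)).card)
  rw [← hMinf]
  exact MAPSelection.risk_le hX β hγ hσ hπ hP hε hMmeas hM M.2
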